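/- **Conventions.** $[\mathbb N]^\infty$ is the family of infinite subsets of $\mathbb N$, and $\mathrm{Fin}$ is the family of finite subsets of $\mathbb N$. The power set $P(\mathbb N)$ is identified with the Cantor space $\{0,1\}^{\mathbb N}$ via characteristic functions, and its subsets carry the subspace topology. Write $b\subseteq^* a$ if $b\setminus a$ is finite. For $a\in[\mathbb N]^\infty$ let $a(n)$ be the $n$-th element in the increasing enumeration of $a$. A set $T\subseteq[\mathbb N]^\infty$ is *unbounded* if there is no $g\in\mathbb N^{\mathbb N}$ such that, for every $a\in T$, $a(n)\le g(n)$ for all but finitely many $n$. An *unbounded tower* $T=\{x_\alpha:\alpha<\aleph_1\}\subseteq[\mathbb N]^\infty$ is an unbounded set enumerated so that $x_\beta\subseteq^* x_\alpha$ for all $\alpha<\beta<\aleph_1$. $C_p(X)$ is the space of continuous functions $X\to\mathbb R$ with the topology inherited from the product $\mathbb R^X$. A topological space is *Fréchet–Urysohn* if every point in the closure of a set is the limit of a sequence of elements of that set. A topological space $Y$ is *strongly Fréchet–Urysohn* if, whenever $A_0\supseteq A_1\supseteq\cdots$ are subsets of $Y$ and $y\in\bigcap_n\overline{A_n}$, there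 are $z_n\in A_n$ with $z_n\to y$. A space $Z$ is *productively Fréchet–Urysohn* if $Z\times Y$ is Fréchet–Urysohn for every strongly Fréchet–Urysohn topological space $Y$. A *cover* of $X$ is a family of subsets of $X$ with union $X$, no single member of which is all of $X$. An open cover $\mathcal U$ of $X$ is an *$\omega$-cover* if each finite subset of $X$ is contained in some member of $\mathcal U$; it is a *$\gamma$-cover* if it is infinite and each point of $X$ belongs to all but finitely many members of $\mathcal U$. A topological space is a *$\gamma$-space* if each of its open $\omega$-covers contains a $\gamma$-cover. A space $X$ is *productively $\gamma$* if $X\times Y$ is a $\gamma$-space for every $\gamma$-space $Y$. **Theorem 2.6.** For every unbounded tower $T=\{x_\alpha:\alpha<\aleph_1\}\subseteq[\mathbb N]^\infty$, the space $C_p(T\cup\mathrm{Fin})$ is productively Fréchet–Urysohn. In particular, the space $T\cup\mathrm{Fin}$ is productively $\gamma$. -/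

import Mathlib

open Set Filter Topology
open scoped Ordinal

universe u v

namespace SelectionPrinciples

/-! ### Function spaces with the topology of pointwise convergence -/

/-- `C_p(X)`: the continuous real-valued functions on `X` with the topology inherited from the
Tychonoff product `ℝ^X` (the subspace topology of the product topology on `X → ℝ`). -/
abbrev Cp (X : Type u) [TopologicalSpace X] : Type u :=
  {f : X → ℝ // Continuous f}

/-! ### Local properties -/

/-- `Y` is strongly Fréchet–Urysohn: whenever a point `y` lies in the closure of every member of a
decreasing sequence `A 0 ⊇ A 1 ⊇ ⋯` of subsets of `Y`, there are `z n ∈ A n` converging to `y`. -/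
def IsStronglyFrechetUrysohn (Y : Type u) [TopologicalSpace Y] : Prop :=
  ∀ (A : ℕ → Set Y) (y : Y), Antitone A → (∀ n, y ∈ closure (A n)) →
    ∃ z : ℕ → Y, (∀ n, z n ∈ A n) ∧ Tendsto z atTop (𝓝 y)

/-- `Z` is productively Fréchet–Urysohn, in the sense of Jordan (and Jordan–Mynard): the product
of `Z` with every strongly Fréchet–Urysohn space is Fréchet–Urysohn. -/
def IsProductivelyFrechetUrysohn (Z : Type u) [TopologicalSpace Z] : Prop :=
  ∀ (Y : Type v) [TopologicalSpace Y], IsStronglyFrechetUrysohn Y → FrechetUrysohnSpace (Z × Y)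

/-! ### Covering properties -/

/-- An open cover of `X`, no single member of which covers `X`. -/
structure IsProperOpenCover {X : Type u} [TopologicalSpace X] (𝒰 : Set (Set X)) : Prop where
  isOpen : ∀ U ∈ 𝒰, IsOpen U
  sUnion_eq : ⋃₀ 𝒰 = univ
  univ_notMem : univ ∉ 𝒰

/-- `𝒰 ∈ Ω(X)`: each finite subset of `X` is contained in some member of `𝒰`. -/
structure IsOmegaCover {X : Type u} [TopologicalSpace X] (𝒰 : Set (Set X)) : Prop
    extends IsProperOpenCover 𝒰 where
  finite_subset : ∀ F : Set X, F.Finite → ∃ U ∈ 𝒰, F ⊆ U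

/-- `𝒰 ∈ Γ(X)`: `𝒰` is infinite, and each point of `X` is contained in all but finitely many
members of `𝒰`. -/
structure IsGammaCover {X : Type u} [TopologicalSpace X] (𝒰 : Set (Set X)) : Prop
    extends IsProperOpenCover 𝒰 where
  infinite : 𝒰.Infinite
  finite_notMem : ∀ x : X, {U ∈ 𝒰 | x ∉ U}.Finite

/-- `X` is a γ-space: each member of `Ω(X)` contains a member of `Γ(X)`. -/
def IsGammaSpace (X : Type u) [TopologicalSpace X] : Prop :=
  ∀ 𝒰 : Set (Set X), IsOmegaCover 𝒰 → ∃ 𝒱 ⊆ 𝒰, IsGammaCover 𝒱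

/-- `X` is productively γ: its product with every γ-space is a γ-space. -/
def IsProductivelyGamma (X : Type u) [TopologicalSpace X] : Prop :=
  ∀ (Y : Type v) [TopologicalSpace Y], IsGammaSpace Y → IsGammaSpace (X × Y)

/-! ### Unbounded towers -/

/-- A family of (infinite) subsets of `ℕ` is unbounded if the increasing enumerations of its
elements are unbounded in `ℕ^ℕ` with respect to eventual domination `≤*`.
(`Nat.nth (· ∈ A) n` is the `n`-th element of the infinite set `A`.) -/
def IsUnboundedFamily (T : Set (Set ℕ)) : Prop :=
  ¬ ∃ g : ℕ → ℕ, ∀ A ∈ T, ∀ᶠ n in atTop, Nat.nth (· ∈ A) n ≤ g n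

/-- `⟨x α : α < ω₁⟩` is an unbounded tower of length `ℵ₁`: a sequence of infinite subsets of `ℕ`,
decreasing with respect to almost inclusion `⊆*`, whose set of terms is unbounded. -/
structure IsUnboundedTower (x : Iio (ω₁ : Ordinal.{0}) → Set ℕ) : Prop where
  infinite : ∀ α, (x α).Infinite
  almost_subset : ∀ α β, α < β → (x β \ x α).Finite
  unbounded : IsUnboundedFamily (range x)

/-- The set `T ∪ Fin` as a subset of the Cantor space `ℕ → Bool`, where `T = {x α : α < ω₁}`,
`Fin` is the family of finite subsets of `ℕ`, and subsets of `ℕ` are identified with their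
characteristic functions. -/
def towerUnionFin (x : Iio (ω₁ : Ordinal.{0}) → Set ℕ) : Set (ℕ → Bool) :=
  Set.boolIndicator '' (range x ∪ {s : Set ℕ | s.Finite})

end SelectionPrinciples

namespace SelectionPrinciples

/-! ### Sequences and γ-covers -/

section GammaSpaces

open TopologicalSpace (Opens)

variable {Y : Type v} [TopologicalSpace Y]

/-! Let `(f₀, y)` lie in the closure of `A`. For each `α < ω₁`, strong Fréchet–Urysohnness of `Y`
yields pairs `(f k, z k)` in `A` with `z k → y` and `f k` close to `f₀` on ever more tower points
below `α` and on all subsets of `{0, …, k - 1}`. By continuity, `f k` is then close to `f₀` at every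
set missing some gap `[k, m k)`. Unboundedness gives a tower term missing infinitely many gaps, and
almost all of these are missed by every later term (`IsUnboundedTower.exists_seq`). Iterating `ω`
times and passing to the supremum, a second use of strong Fréchet–Urysohnness diagonalizes over the
stages (`IsUnboundedTower.exists_seq_tendsto`).

For the γ-statement, a γ-space `Y` is coded by the strongly Fréchet–Urysohn space `OpensNearTop Y`,
and an ω-cover of `X × Y` by a set in `Cp X × OpensNearTop Y` with `(0, ⊤)` in its closure. A
sequence converging to that point gives a γ-cover. -/

theorem isGammaCover_range {U : ℕ → Set Y} (hopen : ∀ n, IsOpen (U n)) (hne : ∀ n, U n ≠ univ)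
    (hev : ∀ y, ∀ᶠ n in atTop, y ∈ U n) : IsGammaCover (range U) where
  isOpen := by rintro _ ⟨n, rfl⟩; exact hopen n
  sUnion_eq := by
    refine eq_univ_of_forall fun y => ?_
    obtain ⟨n, hn⟩ := (hev y).exists
    exact ⟨U n, mem_range_self n, hn⟩
  univ_notMem := by rintro ⟨n, hn⟩; exact hne n hn
  infinite := by
    intro hfin
    have : Finite (range U) := hfin
    -- A set repeated infinitely often contains every point, against properness.
    obtain ⟨V, hV⟩ := Finite.exists_infinite_fiber (rangeFactorization U)
    rw [Set.infinite_coe_iff] at hV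
    obtain ⟨n, hn⟩ := hV.nonempty
    refine hne n (eq_univ_of_forall fun y => ?_)
    obtain ⟨k, hk, hyk⟩ := ((Nat.frequently_atTop_iff_infinite.2 hV).and_eventually (hev y)).exists
    have h : rangeFactorization U k = rangeFactorization U n := hk.trans hn.symm
    have h' : U k = U n := congrArg Subtype.val h
    rwa [← h']
  finite_notMem y := by
    have h : {n | y ∉ U n}.Finite := by
      have := hev y
      rwa [← Nat.cofinite_eq_atTop, eventually_cofinite] at this
    refine (h.image U).subset ?_
    rintro _ ⟨⟨n, rfl⟩, hn⟩
    exact ⟨n, hn, rfl⟩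

theorem IsGammaSpace.exists_seq (hY : IsGammaSpace Y) {𝒰 : Set (Opens Y)} (htop : ⊤ ∉ 𝒰)
    (hω : ∀ F : Set Y, F.Finite → ∃ U ∈ 𝒰, F ⊆ U) :
    ∃ V : ℕ → Opens Y, (∀ n, V n ∈ 𝒰) ∧ ∀ y, ∀ᶠ n in atTop, y ∈ V n := by
  obtain ⟨𝒱, h𝒱, hγ⟩ := hY ((↑) '' 𝒰) {
    isOpen := by rintro _ ⟨U, -, rfl⟩; exact U.isOpen
    sUnion_eq := by
      refine eq_univ_of_forall fun y => ?_
      obtain ⟨U, hU, hy⟩ := hω {y} (finite_singleton y)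
      exact ⟨U, mem_image_of_mem _ hU, hy rfl⟩
    univ_notMem := by
      rintro ⟨U, hU, h⟩
      exact htop (by rwa [← (SetLike.coe_injective (by simpa using h) : U = ⊤)])
    finite_subset := by
      intro F hF
      obtain ⟨U, hU, h⟩ := hω F hF
      exact ⟨U, mem_image_of_mem _ hU, h⟩ }
  have hinf := hγ.infinite
  choose V hV hVe using fun n => h𝒱 (hinf.natEmbedding 𝒱 n).2
  refine ⟨V, hV, fun y => ?_⟩
  rw [← Nat.cofinite_eq_atTop, eventually_cofinite]
  refine ((hγ.finite_notMem y).preimage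
    (Subtype.val_injective.comp (hinf.natEmbedding 𝒱).injective).injOn).subset ?_
  intro n hn
  refine ⟨(hinf.natEmbedding 𝒱 n).2, fun h => hn ?_⟩
  change y ∈ (V n : Set Y)
  rw [hVe]
  exact h

/-- In a γ-space, decreasing sequences of ω-covers admit a diagonal selection converging
pointwise (a form of the Gerlits–Nagy theorem). -/
theorem IsGammaSpace.exists_diagonal_seq (hY : IsGammaSpace Y) {𝒰 : ℕ → Set (Opens Y)}
    (hanti : Antitone 𝒰) (htop : ∀ n, ⊤ ∉ 𝒰 n)
    (hω : ∀ n, ∀ F : Set Y, F.Finite → ∃ U ∈ 𝒰 n, F ⊆ U) :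
    ∃ V : ℕ → Opens Y, (∀ n, V n ∈ 𝒰 n) ∧ ∀ y, ∀ᶠ n in atTop, y ∈ V n := by
  obtain ⟨V, hV, hVev⟩ := hY.exists_seq (htop 0) (hω 0)
  have hVne : ∀ n, ∃ y, y ∉ V n := fun n => by
    by_contra! h
    exact htop 0 (by rw [← (eq_top_iff.2 fun y _ => h y : V n = ⊤)]; exact hV n)
  -- Intersecting with `V n`, which omits a point `p n`, prevents a pointwise convergent selection
  -- from using a fixed index `n` infinitely often.
  obtain ⟨W, hW, hWev⟩ := hY.exists_seq (𝒰 := {W | ∃ n, ∃ U ∈ 𝒰 n, W = V n ⊓ U}) (by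
      rintro ⟨n, U, -, h⟩
      obtain ⟨y, hy⟩ := hVne n
      exact hy ((h.le.trans inf_le_left) (Opens.mem_top y))) (by
      intro F hF
      obtain ⟨n, hn⟩ := ((eventually_all_finite hF).2 fun y _ => hVev y).exists
      obtain ⟨U, hU, hFU⟩ := hω n F hF
      exact ⟨V n ⊓ U, ⟨n, U, hU, rfl⟩, fun y hy => ⟨hn y hy, hFU hy⟩⟩)
  choose i U hU hWU using hW
  choose p hp using hVne
  have hi : ∀ m, ∃ k ≥ m, m ≤ i k := fun m => by
    have h : ∀ᶠ k in atTop, ∀ j ∈ Iio m, p j ∈ W k :=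
      (eventually_all_finite (finite_Iio m)).2 fun j _ => hWev (p j)
    obtain ⟨k, hk, hmk⟩ := (h.and (eventually_ge_atTop m)).exists
    refine ⟨k, hmk, not_lt.1 fun hlt => hp (i k) ?_⟩
    have := hk (i k) hlt
    rw [hWU] at this
    exact this.1
  choose φ hφ hiφ using hi
  refine ⟨fun m => U (φ m), fun m => hanti (hiφ m) (hU _), fun y => ?_⟩
  filter_upwards [(tendsto_atTop_mono hφ tendsto_id).eventually (hWev y)] with m hm
  rw [hWU] at hm
  exact hm.2

/-! ### γ-spaces as a local property at one point. -/

/-- The open subsets of `Y`, topologized so that every proper open set is isolated and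
convergence to the whole space is pointwise. -/
structure OpensNearTop (Y : Type v) [TopologicalSpace Y] : Type v where
  toOpens : Opens Y

namespace OpensNearTop

instance : TopologicalSpace (OpensNearTop Y) :=
  nhdsAdjoint ⟨⊤⟩ (⨅ y : Y, 𝓟 {U : OpensNearTop Y | y ∈ U.toOpens})

theorem nhds_top :
    𝓝 (⟨⊤⟩ : OpensNearTop Y) = ⨅ y : Y, 𝓟 {U : OpensNearTop Y | y ∈ U.toOpens} := by
  refine (nhds_nhdsAdjoint_same _ _).trans (sup_eq_right.2 ?_)
  exact le_iInf fun y => by simp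

theorem nhds_of_ne_top {U : OpensNearTop Y} (hU : U ≠ ⟨⊤⟩) : 𝓝 U = pure U :=
  nhds_nhdsAdjoint_of_ne _ hU

theorem tendsto_top {ι : Type*} {l : Filter ι} {V : ι → OpensNearTop Y} :
    Tendsto V l (𝓝 ⟨⊤⟩) ↔ ∀ y, ∀ᶠ i in l, y ∈ (V i).toOpens := by
  simp only [nhds_top, tendsto_iInf, tendsto_principal, mem_ofPred_eq]

theorem mem_nhds_top {s : Set (OpensNearTop Y)} :
    s ∈ 𝓝 ⟨⊤⟩ ↔ ∃ F : Set Y, F.Finite ∧ ∀ U : Opens Y, F ⊆ U → ⟨U⟩ ∈ s := by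
  rw [nhds_top, (hasBasis_iInf_principal_finite _).mem_iff]
  refine exists_congr fun F => and_congr_right fun _ => ?_
  constructor
  · intro h U hU
    exact h (mem_iInter₂.2 fun y hy => hU hy)
  · intro h U hU
    exact h U.toOpens fun y hy => mem_iInter₂.1 hU y hy

end OpensNearTop

theorem IsGammaSpace.isStronglyFrechetUrysohn_opensNearTop (hY : IsGammaSpace Y) :
    IsStronglyFrechetUrysohn (OpensNearTop Y) := by
  intro A z hA hz
  by_cases hall : ∀ n, z ∈ A n
  · exact ⟨fun _ => z, hall, tendsto_const_nhds⟩
  obtain ⟨N, hN⟩ := not_forall.1 hall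
  by_cases hztop : z = ⟨⊤⟩
  · subst hztop
    obtain ⟨V, hV, hVev⟩ := hY.exists_diagonal_seq
      -- The shift by `N` removes `⊤` from all the families; monotonicity of `A` undoes it
      -- afterwards.
      (𝒰 := fun n => {U : Opens Y | (⟨U⟩ : OpensNearTop Y) ∈ A (n + N)})
      (fun m n h U hU => hA (by lia) hU) (fun n h => hN (hA (Nat.le_add_left N n) h))
      (fun n F hF => by
        obtain ⟨U, hU, hUA⟩ := mem_closure_iff_nhds.1 (hz (n + N)) {U | F ⊆ U.toOpens}
          (OpensNearTop.mem_nhds_top.2 ⟨F, hF, fun U h => h⟩)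
        exact ⟨U.toOpens, hUA, hU⟩)
    exact ⟨fun n => ⟨V n⟩, fun n => hA (Nat.le_add_right n N) (hV n),
      OpensNearTop.tendsto_top.2 hVev⟩
  · obtain ⟨w, hw, hwA⟩ := mem_closure_iff_nhds.1 (hz N) {z}
      (by rw [OpensNearTop.nhds_of_ne_top hztop]; exact mem_pure.2 rfl)
    exact absurd (mem_singleton_iff.1 hw ▸ hwA) hN

/-! ### Function spaces, and from productively Fréchet–Urysohn to productively γ. -/

theorem Cp.exists_finite_of_mem_nhds {X : Type u} [TopologicalSpace X] {f : Cp X} {s : Set (Cp X)}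
    (hs : s ∈ 𝓝 f) : ∃ F : Set X, F.Finite ∧ ∀ g : Cp X, (∀ p ∈ F, g.1 p = f.1 p) → g ∈ s := by
  rw [nhds_subtype_eq_comap, mem_comap] at hs
  obtain ⟨t, ht, hts⟩ := hs
  rw [nhds_pi, mem_pi'] at ht
  obtain ⟨I, u, hu, hut⟩ := ht
  refine ⟨I, I.finite_toSet, fun g hg => hts (hut fun p hp => ?_)⟩
  rw [hg p hp]
  exact mem_of_mem_nhds (hu p)

theorem Cp.tendsto_iff {X : Type u} [TopologicalSpace X] {ι : Type*} {l : Filter ι}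
    {f : ι → Cp X} {g : Cp X} :
    Tendsto f l (𝓝 g) ↔ ∀ p, Tendsto (fun i => (f i).1 p) l (𝓝 (g.1 p)) := by
  rw [tendsto_subtype_rng, tendsto_pi_nhds]

theorem exists_continuous_zero_one_of_finite {X : Type u} [TopologicalSpace X]
    [CompletelyRegularSpace X] {F V : Set X} (hF : F.Finite) (hV : IsOpen V) (hFV : F ⊆ V) :
    ∃ f : X → ℝ, Continuous f ∧ (∀ p ∈ F, f p = 0) ∧ ∀ p ∉ V, f p = 1 := by
  have h : ∀ q : F, ∃ f : X → ℝ, Continuous f ∧ f q = 0 ∧ ∀ p ∉ V, f p = 1 := fun q => by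
    obtain ⟨f, hf, h0, h1⟩ := CompletelyRegularSpace.completely_regular_isOpen q.1 V hV (hFV q.2)
    exact ⟨fun p => f p, continuous_subtype_val.comp hf, by simp [h0], fun p hp => by simp [h1 hp]⟩
  choose f hf h0 h1 using h
  have := hF.fintype
  refine ⟨fun p => ∏ q, f q p, continuous_finsetProd _ fun q _ => hf q, fun p hp => ?_,
    fun p hp => Finset.prod_eq_one fun q _ => h1 q p hp⟩
  exact Finset.prod_eq_zero (Finset.mem_univ ⟨p, hp⟩) (h0 ⟨p, hp⟩)

theorem IsProductivelyFrechetUrysohn.isProductivelyGamma {X : Type u} [TopologicalSpace X]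
    [CompletelyRegularSpace X] (hX : IsProductivelyFrechetUrysohn.{u, v} (Cp X)) :
    IsProductivelyGamma.{u, v} X := by
  intro Y _ hY 𝒰 h𝒰
  have _ := hX (OpensNearTop Y) hY.isStronglyFrechetUrysohn_opensNearTop
  -- A pair `(f, W)` is in `A` when the open box `{f < 1} × W` lies in one member of the cover.
  let A : Set (Cp X × OpensNearTop Y) :=
    {q | ∃ U ∈ 𝒰, ∀ p y, q.1.1 p < 1 → y ∈ q.2.toOpens → (p, y) ∈ U}
  let zero : Cp X := ⟨fun _ => 0, continuous_const⟩
  have hcl : ((zero, ⟨⊤⟩) : Cp X × OpensNearTop Y) ∈ closure A := by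
    rw [mem_closure_iff_nhds]
    intro t ht
    obtain ⟨s, hs, w, hw, hsw⟩ := mem_nhds_prod_iff.1 ht
    obtain ⟨F, hF, hFs⟩ := Cp.exists_finite_of_mem_nhds hs
    obtain ⟨G, hG, hGw⟩ := OpensNearTop.mem_nhds_top.1 hw
    obtain ⟨U, hU, hFGU⟩ := h𝒰.finite_subset (F ×ˢ G) (hF.prod hG)
    obtain ⟨V, W, hV, hW, hFV, hGW, hVW⟩ :=
      generalized_tube_lemma hF.isCompact hG.isCompact (h𝒰.isOpen U hU) hFGU
    obtain ⟨f, hf, hf0, hf1⟩ := exists_continuous_zero_one_of_finite hF hV hFV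
    refine ⟨(⟨f, hf⟩, ⟨⟨W, hW⟩⟩), hsw ⟨hFs _ hf0, hGw _ hGW⟩, U, hU,
      fun p y hp hy => hVW ⟨?_, hy⟩⟩
    by_contra hpV
    exact hp.ne (hf1 p hpV)
  obtain ⟨q, hqA, hq⟩ := mem_closure_iff_seq_limit.1 hcl
  choose U hU hqU using hqA
  refine ⟨range U, range_subset_iff.2 hU, isGammaCover_range (fun n => h𝒰.isOpen _ (hU n))
    (fun n h => h𝒰.univ_notMem (h ▸ hU n)) ?_⟩
  rintro ⟨p, y⟩
  obtain ⟨h1, h2⟩ := Prod.tendsto_iff _ _ |>.1 hq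
  filter_upwards [(Cp.tendsto_iff.1 h1 p).eventually_lt_const one_pos,
    OpensNearTop.tendsto_top.1 h2 y] with n hn hn'
  exact hqU n p y hn hn'

end GammaSpaces

/-! ### Unbounded towers -/

/-- Otherwise each `a ∈ T` meets almost all intervals `[k, m k)`, and iterating `m` produces a bound
for the enumerations. -/
theorem IsUnboundedFamily.exists_frequently_disjoint {T : Set (Set ℕ)} (hT : IsUnboundedFamily T)
    (m : ℕ → ℕ) :
    ∃ a ∈ T, ∃ᶠ k in atTop, ∀ i, k ≤ i → i < m k → i ∉ a := by
  classical
  by_contra! hcon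
  let h : ℕ → ℕ := fun n => n.rec 0 fun _ k => max (k + 1) (m k)
  have hsucc : ∀ n, h (n + 1) = max (h n + 1) (m (h n)) := fun n => rfl
  have hmono : StrictMono h := strictMono_nat_of_lt_succ fun n => by rw [hsucc]; lia
  -- From some `N` on, `a` meets each `[h n, h (n + 1))`, so its `n`-th element is below `h (N + n +
  -- 1)`; for `n ≥ N` the index `2 * n + 1` absorbs `N`, which depends on `a`.
  refine hT ⟨fun n => h (2 * n + 1), fun a ha => ?_⟩
  obtain ⟨N, hN⟩ := eventually_atTop.1 (hcon a ha)
  have hcount : ∀ n, n ≤ Nat.count (· ∈ a) (h (N + n)) := fun n => by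
    induction n with
    | zero => exact Nat.zero_le _
    | succ n ih =>
      obtain ⟨i, hi, him, hia⟩ := hN (h (N + n)) ((Nat.le_add_right N n).trans hmono.le_apply)
      have h1 : Nat.count (· ∈ a) i < Nat.count (· ∈ a) (h (N + (n + 1))) :=
        Nat.count_strict_mono hia (him.trans_le (by rw [← add_assoc, hsucc]; lia))
      have h2 := Nat.count_monotone (· ∈ a) hi
      lia
  filter_upwards [eventually_ge_atTop N] with n hn
  refine (Nat.nth_lt_of_lt_count ((Nat.lt_succ_self n).trans_le ?_)).le
  exact (hcount (n + 1)).trans (Nat.count_monotone _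
    (hmono.monotone (by lia : N + (n + 1) ≤ 2 * n + 1)))

/-- An open set containing all subsets of `{0, …, k - 1}` contains all sets which avoid a
suitable interval `[k, m)`. -/
theorem exists_gap_of_isOpen {X : Set (ℕ → Bool)} {O : Set X} (hO : IsOpen O) {k : ℕ}
    (hX : ∀ p : ℕ → Bool, (∀ i, k ≤ i → p i = false) → ∃ h : p ∈ X, ⟨p, h⟩ ∈ O) :
    ∃ m, ∀ p : X, (∀ i, k ≤ i → i < m → p.1 i = false) → p ∈ O := by
  obtain ⟨V, hV, rfl⟩ := isOpen_induced_iff.1 hO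
  rw [isOpen_pi_iff] at hV
  let trunc : (ℕ → Bool) → ℕ → Bool := fun p i => if i < k then p i else false
  have hfin : (range trunc).Finite := by
    let ext : (Fin k → Bool) → ℕ → Bool := fun q i => if h : i < k then q ⟨i, h⟩ else false
    refine (finite_range ext).subset ?_
    rintro _ ⟨p, rfl⟩
    exact ⟨fun i => p i, funext fun i => by simp [ext, trunc]⟩
  -- There are finitely many truncations, so one `m` can exceed all coordinates restricted by their
  -- basic neighbourhoods.
  have hm : ∀ t ∈ range trunc, ∀ᶠ m in atTop, ∀ p : ℕ → Bool,
      (∀ i < m, p i = t i) → p ∈ V := by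
    rintro _ ⟨q, rfl⟩
    obtain ⟨_, hq⟩ := hX (trunc q) fun i hi => if_neg hi.not_gt
    obtain ⟨I, u, hu, hIV⟩ := hV _ hq
    filter_upwards [eventually_gt_atTop (I.sup id)] with m hm p hp
    refine hIV fun i hi => ?_
    rw [hp i ((Finset.le_sup (f := id) hi).trans_lt hm)]
    exact (hu i hi).2
  obtain ⟨m, hm⟩ := ((eventually_all_finite hfin).2 hm).exists
  refine ⟨m, fun p hp => hm _ (mem_range_self p.1) p.1 fun i hi => ?_⟩
  by_cases hik : i < k
  · exact (if_pos hik).symm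
  · exact (hp i (not_lt.1 hik) hi).trans (if_neg hik).symm

/-! ### Initial segments and points of the tower. -/

theorem countable_Iio_of_Iio_omega_one (α : Iio (ω₁ : Ordinal.{0})) : (Iio α).Countable := by
  have h : (Iio α.1).Countable := by
    rw [← Cardinal.le_aleph0_iff_set_countable, Cardinal.mk_Iio_ordinal]
    have h1 : α.1.card < Cardinal.aleph 1 :=
      Cardinal.lt_ord.1 (by rw [Cardinal.ord_aleph]; exact α.2)
    rw [← Cardinal.succ_aleph0, Order.lt_succ_iff] at h1
    rwa [Cardinal.lift_le_aleph0]
  exact (h.preimage Subtype.val_injective).mono fun β hβ => hβ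

variable {x : Iio (ω₁ : Ordinal.{0}) → Set ℕ}

theorem IsUnboundedTower.finite_diff_of_le (hx : IsUnboundedTower x)
    {α β : Iio (ω₁ : Ordinal.{0})} (h : α ≤ β) : (x β \ x α).Finite := by
  rcases h.eq_or_lt with rfl | h
  · simp
  · exact hx.almost_subset α β h

/-- Beyond the finite set `x β \ x α`, gaps of `x α` pass to later terms. -/
theorem IsUnboundedTower.eventually_gap (hx : IsUnboundedTower x) {α β : Iio (ω₁ : Ordinal.{0})}
    (h : α ≤ β) (m : ℕ → ℕ) :
    ∀ᶠ k in atTop, (∀ i, k ≤ i → i < m k → i ∉ x α) → ∀ i, k ≤ i → i < m k → i ∉ x β := by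
  obtain ⟨N, hN⟩ := (hx.finite_diff_of_le h).bddAbove
  filter_upwards [eventually_gt_atTop N] with k hk hα i hi him hiβ
  exact absurd (hN ⟨hiβ, hα i hi him⟩) (by lia)

/-- The point of `towerUnionFin x` given by the term `x β` of the tower. -/
noncomputable def towerPoint (x : Iio (ω₁ : Ordinal.{0}) → Set ℕ) (β : Iio (ω₁ : Ordinal.{0})) :
    towerUnionFin x :=
  ⟨boolIndicator (x β), mem_image_of_mem _ (Or.inl (mem_range_self β))⟩

theorem mem_towerUnionFin_of_eventually_false {p : ℕ → Bool} {k : ℕ}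
    (hp : ∀ i, k ≤ i → p i = false) : p ∈ towerUnionFin x := by
  refine ⟨{i | p i = true}, Or.inr ((finite_lt_nat k).subset fun i hi => ?_), ?_⟩
  · by_contra h
    exact absurd (hp i (not_lt.1 h)) (by simpa using hi)
  · funext i
    cases h : p i
    · exact (notMem_iff_boolIndicator _ _).1 (by simp [h])
    · exact (mem_iff_boolIndicator _ _).1 h

theorem towerPoint_apply_eq_false {β : Iio (ω₁ : Ordinal.{0})} {i : ℕ} (h : i ∉ x β) :
    (towerPoint x β).1 i = false :=
  (notMem_iff_boolIndicator _ _).1 h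

theorem eq_towerPoint_or_eventually_false (p : towerUnionFin x) :
    (∃ β, p = towerPoint x β) ∨ ∃ k, ∀ i, k ≤ i → p.1 i = false := by
  obtain ⟨_, s, ⟨β, rfl⟩ | hs, rfl⟩ := p
  · exact Or.inl ⟨β, rfl⟩
  · obtain ⟨N, hN⟩ := Set.Finite.bddAbove hs
    exact Or.inr ⟨N + 1, fun i hi => (notMem_iff_boolIndicator _ _).1
      fun h => absurd (hN h) (by lia)⟩

theorem Cp.eventually_forall_abs_sub_lt {X : Type u} [TopologicalSpace X] (f : Cp X) {F : Set X}
    (hF : F.Finite) {ε : ℝ} (hε : 0 < ε) : ∀ᶠ g : Cp X in 𝓝 f, ∀ p ∈ F, |g.1 p - f.1 p| < ε :=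
  (eventually_all_finite hF).2 fun p _ =>
    (Cp.tendsto_iff.1 tendsto_id p).eventually (eventually_abs_sub_lt (f.1 p) hε)

/-! ### The two diagonalizations. -/

variable {Y : Type v} [TopologicalSpace Y]

/-- A sequence in `A` converging to `(f₀, y)` on an initial segment of the tower, and along a
subsequence on a final segment. -/
theorem IsUnboundedTower.exists_seq (hx : IsUnboundedTower x) (hY : IsStronglyFrechetUrysohn Y)
    {A : Set (Cp (towerUnionFin x) × Y)} {f₀ : Cp (towerUnionFin x)} {y : Y}
    (hA : (f₀, y) ∈ closure A) (α : Iio (ω₁ : Ordinal.{0})) :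
    ∃ α' ≥ α, ∃ (f : ℕ → Cp (towerUnionFin x)) (z : ℕ → Y) (m : ℕ → ℕ),
      (∀ k, (f k, z k) ∈ A) ∧ Tendsto z atTop (𝓝 y) ∧
      (∀ β < α, Tendsto (fun k => (f k).1 (towerPoint x β)) atTop (𝓝 (f₀.1 (towerPoint x β)))) ∧
      (∀ k (p : towerUnionFin x), (∀ i, k ≤ i → i < m k → p.1 i = false) →
        |(f k).1 p - f₀.1 p| < 1 / (k + 1)) ∧
      ∃ᶠ k in atTop, ∀ i, k ≤ i → i < m k → i ∉ x α' := by
  obtain ⟨c, hc⟩ := countable_iff_exists_injOn.1 (countable_Iio_of_Iio_omega_one α)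
  -- These finite sets exhaust the tower below `α`; the second piece, all subsets of `{0, …, k -
  -- 1}`, is what `exists_gap_of_isOpen` needs.
  let C : ℕ → Set (towerUnionFin x) := fun k =>
    towerPoint x '' {β | β < α ∧ c β < k} ∪ {p | ∀ i, k ≤ i → p.1 i = false}
  have hC : ∀ k, (C k).Finite := fun k => by
    refine Finite.union (Finite.image _ ?_) ?_
    · exact Finite.of_injOn (f := c) (t := Iio k) (fun β hβ => hβ.2)
        (hc.mono fun β hβ => hβ.1) (finite_Iio k)
    · refine Finite.of_injOn (f := fun p (i : Fin k) => p.1 i) (t := univ) (mapsTo_univ _ _)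
        (fun p hp q hq hpq => Subtype.ext (funext fun i => ?_)) finite_univ
      by_cases hi : i < k
      · exact congrFun hpq ⟨i, hi⟩
      · rw [hp i (not_lt.1 hi), hq i (not_lt.1 hi)]
  have hCmono : Monotone C := fun k l hkl => union_subset_union
    (image_mono fun β hβ => ⟨hβ.1, hβ.2.trans_le hkl⟩) fun p hp i hi => hp i (hkl.trans hi)
  let B : ℕ → Set Y := fun k => {w | ∃ f, (f, w) ∈ A ∧ ∀ p ∈ C k, |f.1 p - f₀.1 p| < 1 / (k + 1)}
  have hB : Antitone B := fun k l hkl w ⟨f, hf, hfC⟩ =>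
    ⟨f, hf, fun p hp => (hfC p (hCmono hkl hp)).trans_le (by gcongr)⟩
  have hBcl : ∀ k, y ∈ closure (B k) := fun k => by
    rw [mem_closure_iff_nhds]
    intro t ht
    obtain ⟨⟨f, w⟩, ⟨hf, hw⟩, hfw⟩ := mem_closure_iff_nhds.1 hA _
      (prod_mem_nhds
        (Cp.eventually_forall_abs_sub_lt f₀ (hC k) (Nat.one_div_pos_of_nat (α := ℝ) (n := k))) ht)
    exact ⟨w, hw, f, hfw, hf⟩
  obtain ⟨z, hz, hzy⟩ := hY B y hB hBcl
  choose f hf hfC using hz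
  have hgap : ∀ k, ∃ m, ∀ p : towerUnionFin x, (∀ i, k ≤ i → i < m → p.1 i = false) →
      |(f k).1 p - f₀.1 p| < 1 / (k + 1) := fun k =>
    exists_gap_of_isOpen (O := {p | |(f k).1 p - f₀.1 p| < 1 / (k + 1)})
      (isOpen_lt ((f k).2.sub f₀.2).abs continuous_const)
      fun p hp => ⟨mem_towerUnionFin_of_eventually_false hp, hfC k _ (Or.inr hp)⟩
  choose m hm using hgap
  obtain ⟨_, ⟨α₁, rfl⟩, hα₁⟩ := hx.unbounded.exists_frequently_disjoint m
  refine ⟨max α α₁, le_max_left _ _, f, z, m, hf, hzy, fun β hβ => ?_, hm, ?_⟩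
  · rw [tendsto_iff_dist_tendsto_zero]
    refine squeeze_zero' (Eventually.of_forall fun _ => dist_nonneg) ?_
      tendsto_one_div_add_atTop_nhds_zero_nat
    filter_upwards [eventually_gt_atTop (c β)] with k hk
    exact (hfC k _ (Or.inl (mem_image_of_mem _ ⟨hβ, hk⟩))).le
  · exact (hα₁.and_eventually (hx.eventually_gap (le_max_right _ _) m)).mono fun k hk => hk.2 hk.1

theorem IsUnboundedTower.exists_seq_tendsto (hx : IsUnboundedTower x)
    (hY : IsStronglyFrechetUrysohn Y) {A : Set (Cp (towerUnionFin x) × Y)}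
    {f₀ : Cp (towerUnionFin x)} {y : Y} (hA : (f₀, y) ∈ closure A) :
    ∃ q : ℕ → Cp (towerUnionFin x) × Y, (∀ n, q n ∈ A) ∧ Tendsto q atTop (𝓝 (f₀, y)) := by
  choose next hnext f z m hfz hzy hlow hgap hfreq using hx.exists_seq hY hA
  let a : ℕ → Iio (ω₁ : Ordinal.{0}) :=
    fun n => n.rec ⟨0, Ordinal.omega_pos 1⟩ fun _ α => next α
  have ha : Monotone a := monotone_nat_of_le_succ fun n => hnext (a n)
  let α : Iio (ω₁ : Ordinal.{0}) := ⟨⨆ n, (a n).1, Ordinal.iSup_lt_omega_one fun n => (a n).2⟩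
  have haα : ∀ n, a n ≤ α := fun n => Ordinal.le_iSup (fun n => (a n).1) n
  have hltα : ∀ β < α, ∃ n, β < a n := fun β hβ => Ordinal.lt_iSup_iff.1 hβ
  obtain ⟨c, hc⟩ := countable_iff_exists_injOn.1 (countable_Iio_of_Iio_omega_one α)
  -- The gap clause will control tower points from `α` on, the last clause those below `α`, and `j ≤
  -- k` the finite sets.
  let good : ℕ → ℕ → Prop := fun j k => j ≤ k ∧
    (∀ i, k ≤ i → i < m (a j) k → i ∉ x α) ∧
    ∀ β ∈ {β | β < a j ∧ c β < j},
      |(f (a j) k).1 (towerPoint x β) - f₀.1 (towerPoint x β)| < 1 / (j + 1)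
  have hgood : ∀ j, ∃ᶠ k in atTop, good j k := fun j => by
    have hfin : {β | β < a j ∧ c β < j}.Finite :=
      Finite.of_injOn (f := c) (t := Iio j) (fun β hβ => hβ.2)
        (hc.mono fun β hβ => hβ.1.trans_le (haα j)) (finite_Iio j)
    have h1 := (eventually_all_finite hfin).2 fun β hβ =>
      (hlow (a j) β hβ.1).eventually
        (eventually_abs_sub_lt _ (Nat.one_div_pos_of_nat (α := ℝ) (n := j)))
    -- The index is `j + 1` because the gaps of stage `a j` are missed by the term at `next (a j)`.
    have h2 := hx.eventually_gap (haα (j + 1)) (m (a j))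
    exact ((hfreq (a j)).and_eventually ((eventually_ge_atTop j).and (h1.and h2))).mono
      fun k ⟨hk, hjk, hk1, hk2⟩ => ⟨hjk, hk2 hk, hk1⟩
  -- The point `y` is in each closure since stage `n` alone has infinitely many good `k`, along
  -- which `z (a n) k → y`.
  let B : ℕ → Set Y := fun n => {w | ∃ j ≥ n, ∃ k, good j k ∧ z (a j) k = w}
  obtain ⟨w, hw, hwy⟩ := hY B y (fun n l hnl w ⟨j, hj, h⟩ => ⟨j, hnl.trans hj, h⟩) fun n => by
    refine mem_closure_of_frequently_of_tendsto ?_ (hzy (a n))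
    exact (hgood n).mono fun k hk => ⟨n, le_rfl, k, hk, rfl⟩
  choose j hj k hk hzw using hw
  have hk_top : Tendsto (fun n => k n) atTop atTop :=
    tendsto_atTop_mono (fun n => (hj n).trans (hk n).1) tendsto_id
  have hj_top : Tendsto j atTop atTop := tendsto_atTop_mono hj tendsto_id
  refine ⟨fun n => (f (a (j n)) (k n), w n), fun n => by simpa only [hzw] using hfz (a (j n)) (k n),
    Tendsto.prodMk_nhds (Cp.tendsto_iff.2 fun p => ?_) hwy⟩
  rw [tendsto_iff_dist_tendsto_zero]
  suffices h : ∀ᶠ n in atTop, |(f (a (j n)) (k n)).1 p - f₀.1 p| ≤ 1 / ((n : ℝ) + 1) from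
    squeeze_zero' (Eventually.of_forall fun _ => dist_nonneg) h
      tendsto_one_div_add_atTop_nhds_zero_nat
  have hgap' : (∀ᶠ n in atTop, ∀ i, k n ≤ i → i < m (a (j n)) (k n) → p.1 i = false) →
      ∀ᶠ n in atTop, |(f (a (j n)) (k n)).1 p - f₀.1 p| ≤ 1 / ((n : ℝ) + 1) := fun h =>
    h.mono fun n hn => (hgap _ _ p hn).le.trans <| by
      have := (hj n).trans (hk n).1
      gcongr
  rcases eq_towerPoint_or_eventually_false p with ⟨β, rfl⟩ | ⟨N, hN⟩
  · rcases lt_or_ge β α with hβ | hβ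
    · obtain ⟨N, hN⟩ := hltα β hβ
      filter_upwards [hj_top.eventually_ge_atTop N, hj_top.eventually_gt_atTop (c β)] with n h1 h2
      refine ((hk n).2.2 β ⟨hN.trans_le (ha h1), h2⟩).le.trans ?_
      have := hj n
      gcongr
    -- Here `x β` is almost contained in `x α`, so it misses the gaps once `k n` passes the finite
    -- difference.
    · refine hgap' ?_
      obtain ⟨N, hN⟩ := (hx.finite_diff_of_le hβ).bddAbove
      filter_upwards [hk_top.eventually_gt_atTop N] with n hn i hi him
      refine towerPoint_apply_eq_false fun hiβ => ?_
      exact absurd (hN ⟨hiβ, (hk n).2.1 i hi him⟩) (by lia)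
  · refine hgap' ?_
    filter_upwards [hk_top.eventually_ge_atTop N] with n hn i hi _
    exact hN i (hn.trans hi)

theorem IsUnboundedTower.isProductivelyFrechetUrysohn (hx : IsUnboundedTower x) :
    IsProductivelyFrechetUrysohn.{0, v} (Cp (towerUnionFin x)) := fun _ _ hY =>
  ⟨fun _ _ hq => hx.exists_seq_tendsto hY hq⟩

end SelectionPrinciples

theorem theorem2p6 (x : Iio (ω₁ : Ordinal.{0}) → Set ℕ)
    (hx : SelectionPrinciples.IsUnboundedTower x) :
    SelectionPrinciples.IsProductivelyFrechetUrysohn.{0, u}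
        (SelectionPrinciples.Cp (SelectionPrinciples.towerUnionFin x)) ∧
      SelectionPrinciples.IsProductivelyGamma.{0, v} (SelectionPrinciples.towerUnionFin x) :=
  ⟨hx.isProductivelyFrechetUrysohn, hx.isProductivelyFrechetUrysohn.isProductivelyGamma⟩
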